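/- Setting. Let $L^2(X)=L^2(X,\mu;\mathbb{R})$, let $\Lambda\subseteq\mathbb{R}^P$ be open, let $g\in L^2(X)$ have unit norm, let $U(\lambda)$, $\lambda\in\Lambda$, be linear isometries of $L^2(X)$, and put $g_\lambda=U(\lambda)g$. Assume that $\lambda\mapsto g_\lambda\in L^2(X)$ is of class $C^2$ on $\Lambda$ and that the matrix $\mathcal{G}_{ij}(\lambda)=\langle\partial_i g_\lambda,\partial_j g_\lambda\rangle$ is positive definite for every $\lambda\in\Lambda$; write $\mathcal{G}^{ij}$ for its inverse and $|\xi|_\lambda^2=\xi^i\xi^j\mathcal{G}_{ij}(\lambda)$. Let $d_{\mathcal{G}}(\lambda_a,\lambda_b)=\inf_\gamma\int_0^1\|\tfrac{d}{dt}g_{\gamma(t)}\|\,dt$, over the $C^1$ curves $\gamma:[0,1]\to\Lambda$ from $\lambda_a$ to $\lambda_b$, and assume that any two points of $\Lambda$ are joined by a shortest curve, i.e. by a $C^2$ curve $\gamma:[0,d]\to\Lambda$ in arc length parametrization ($|\gamma'|=1$) with $d=d_{\mathcal{G}}(\lambda_a,\lambda_b)$. Let $$\mathcal{K}=\sup_{\lambda\in\Lambda}\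 \sup_{|\xi|_\lambda=1}\ \Big\|\tfrac{d^2}{ds^2}g_{\gamma_\xi(s)}\big|_{s=0}\Big\|,$$ where $\gamma_\xi$ is the geodesic of the Riemannian manifold $(\Lambda,\mathcal{G}_{ij})$ with $\gamma_\xi(0)=\lambda$ and $\gamma_\xi'(0)=\xi$. Let $\mathcal{S}\subseteq L^2(X)$ be a Hilbert space (with the norm of $L^2(X)$) that contains all $g_\lambda$, put $S_u(\lambda)=\langle g_\lambda,u\rangle^2$, assume that $S_u$ attains its supremum over $\Lambda$ for every $u\in\mathcal{S}$, and let $\beta\ge 0$ be given by $\beta^2=\inf_{u\in\mathcal{S},\|u\|=1}\sup_{\lambda\in\Lambda}S_u(\lambda)$. Let $\Lambda_{\rm d}\subseteq\Lambda$ be countable and $\rho_{\rm d}=\sup_{\lambda\in\Lambda}\inf_{k\in\Lambda_{\rm d}}d_{\mathcal{G}}(\lambda,k)$. Algorithms. For $\alpha\in(0,1]$ the continuous weak matching pursuit cMP$(\alpha)$ of $f$ is $R^0f=f$, $R^{m+1}f=R^mf-\langle g_{\lambda_{m+1}},R^mf\rangle g_{\lambda_{m+1}}$ with $\lambda_{m+1}\in\Lambda$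 and $S_{R^mf}(\lambda_{m+1})\ge\alpha^2\sup_{\lambda\in\Lambda}S_{R^mf}(\lambda)$. The gradient ascent of $S_u$ from $k\in\Lambda_{\rm d}$ is $\phi_0(k)=k$, $\phi_{r+1}(k)=\phi_r(k)+t_r\,\xi_r$, where $\xi_r=|\nabla S_u|^{-1}\nabla S_u$ at $\phi_r(k)$ (and $\xi_r=0$ if the gradient vanishes), $\nabla^iS_u=\mathcal{G}^{ij}\partial_jS_u$, and the step sizes $t_r=t_r(u,k)>0$ are chosen such that $\phi_{r+1}(k)\in\Lambda$ and $S_u(\phi_{r+1}(k))\ge S_u(\phi_r(k))$. Given positive integers $\kappa_m$, the geometrically optimized matching pursuit gMP$(\alpha)$ of $f$ is $R^0f=f$, $R^{m+1}f=R^mf-\langle g_{\nu_{m+1}},R^mf\rangle g_{\nu_{m+1}}$, where $\nu_{m+1}$ is chosen among the points $\phi_{\kappa_m}(k)$, $k\in\Lambda_{\rm d}$, of the gradient ascents of $S_{R^mf}$, such that $S_{R^mf}(\nu_{m+1})\ge\alpha^2\sup_{k\in\Lambda_{\rm d}}S_{R^mf}(\phi_{\kappa_m}(k))$. Theorem 2.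 Assume $\beta>0$, $\mathcal{K}<\infty$ and $\rho_{\rm d}<\beta/\sqrt{1+\mathcal{K}}$, let $\alpha\in(0,1]$, and put $$\alpha'=\alpha\big(1-\beta^{-2}\rho_{\rm d}^2(1+\mathcal{K})\big)^{1/2},\qquad \alpha''=\alpha\big(1-\tfrac12\beta^{-2}\rho_{\rm d}^2(1+\mathcal{K})\big)^{1/2}.$$ Then $0<\alpha''\le\alpha$ and $\alpha^2-\alpha''^2=\tfrac12(\alpha^2-\alpha'^2)$; every cMP$(\alpha'')$ of a function $f\in\mathcal{S}$ satisfies $\|R^mf\|^2\le(1-\alpha''^2\beta^2)^m\|f\|^2$ for all $m$; and, for every choice rule of the step sizes as above, there is a sequence of positive integers $\kappa_m$ such that every gMP$(\alpha)$ of a function $f\in\mathcal{S}$, optimized by $\kappa_m$ steps at iteration $m$, converges at least at the same rate: $\|R^mf\|^2\le(1-\alpha''^2\beta^2)^m\|f\|^2$ for all $m$. -/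

import Mathlib

open scoped ENNReal Matrix

noncomputable section

namespace GeomMP

/-! Parameters live in coordinates `Fin P → ℝ`; a dictionary is a map `a` sending a parameter `x`
to the atom `a x` of a real inner product space `H`, used on a parameter set `Λ`. -/

variable {P : ℕ} {H : Type*} [NormedAddCommGroup H] [InnerProductSpace ℝ H]

/-- Partial derivative with respect to the `i`-th coordinate. -/
def pderiv {F : Type*} [NormedAddCommGroup F] [NormedSpace ℝ F]
    (i : Fin P) (h : (Fin P → ℝ) → F) (x : Fin P → ℝ) : F :=
  fderiv ℝ h x (Pi.single i 1)

/-- The metric `G_ij(x) = ⟨∂_i a_x, ∂_j a_x⟩` induced by the dictionary. -/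
def metric (a : (Fin P → ℝ) → H) (x : Fin P → ℝ) : Matrix (Fin P) (Fin P) ℝ :=
  Matrix.of fun i j => inner ℝ (pderiv i a x) (pderiv j a x)

/-- The Riemannian norm `|ξ|_x = (ξ^i ξ^j G_ij(x))^{1/2}` of a tangent vector at `x`. -/
def tangentNorm (a : (Fin P → ℝ) → H) (x ξ : Fin P → ℝ) : ℝ :=
  √(∑ i, ∑ j, ξ i * ξ j * metric a x i j)

/-- The Christoffel symbols
`Γ^k_ij = (1/2) G^{kl} (∂_j G_li + ∂_i G_jl - ∂_l G_ij)` of the metric. -/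
def christoffel (a : (Fin P → ℝ) → H) (k i j : Fin P) (x : Fin P → ℝ) : ℝ :=
  (1 / 2) * ∑ l, (metric a x)⁻¹ k l *
    (pderiv j (fun y => metric a y l i) x + pderiv i (fun y => metric a y j l) x
      - pderiv l (fun y => metric a y i j) x)

/-- `γ` is a geodesic of `(Λ, G)` on the open set `I` of times: it is of class `C²`, stays in `Λ`
and satisfies `γ''^k + Γ^k_ij γ'^i γ'^j = 0`. -/
structure IsGeodesicOn (a : (Fin P → ℝ) → H) (Λ : Set (Fin P → ℝ))
    (γ : ℝ → (Fin P → ℝ)) (I : Set ℝ) : Prop where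
  mem : ∀ s ∈ I, γ s ∈ Λ
  contDiffOn : ContDiffOn ℝ 2 γ I
  equation : ∀ s ∈ I, ∀ k : Fin P,
    deriv (deriv γ) s k +
      ∑ i, ∑ j, christoffel a k i j (γ s) * deriv γ s i * deriv γ s j = 0

/-- The principal curvature at `x`: the supremum over the unit tangent vectors `ξ` at `x` of
`‖d²/ds² a_{γ_ξ(s)}‖` at `s = 0`, where `γ_ξ` is the geodesic with `γ_ξ(0) = x`, `γ_ξ'(0) = ξ`. -/
def principalCurvature (a : (Fin P → ℝ) → H) (Λ : Set (Fin P → ℝ)) (x : Fin P → ℝ) : ℝ≥0∞ :=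
  ⨆ (ξ : Fin P → ℝ) (_ : tangentNorm a x ξ = 1) (γ : ℝ → (Fin P → ℝ))
    (_ : ∃ ε > 0, IsGeodesicOn a Λ γ (Set.Ioo (-ε) ε)) (_ : γ 0 = x) (_ : deriv γ 0 = ξ),
    ‖deriv (deriv fun s => a (γ s)) 0‖ₑ

/-- The supremum of the principal curvatures, possibly infinite. -/
def maxCurvature (a : (Fin P → ℝ) → H) (Λ : Set (Fin P → ℝ)) : ℝ≥0∞ :=
  ⨆ x ∈ Λ, principalCurvature a Λ x

/-- The condition number of the dictionary (zero when the curvature is unbounded). -/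
def conditionNumber (a : (Fin P → ℝ) → H) (Λ : Set (Fin P → ℝ)) : ℝ≥0∞ :=
  (maxCurvature a Λ)⁻¹

/-- `γ` is a `C¹` curve in `Λ`, defined on `[0, 1]`, from `x` to `y`. -/
structure IsCurve (Λ : Set (Fin P → ℝ)) (x y : Fin P → ℝ) (γ : ℝ → (Fin P → ℝ)) : Prop where
  mem : ∀ t ∈ Set.Icc (0 : ℝ) 1, γ t ∈ Λ
  contDiffOn : ContDiffOn ℝ 1 γ (Set.Icc 0 1)
  source : γ 0 = x
  target : γ 1 = y

/-- The length `∫₀¹ ‖d/dt a_{γ(t)}‖ dt`. -/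
def curveLength (a : (Fin P → ℝ) → H) (γ : ℝ → (Fin P → ℝ)) : ℝ≥0∞ :=
  ∫⁻ t in Set.Icc (0 : ℝ) 1, ‖derivWithin (fun r => a (γ r)) (Set.Icc 0 1) t‖ₑ

/-- The geodesic distance (infinite if no curve joins the points). -/
def geodesicDist (a : (Fin P → ℝ) → H) (Λ : Set (Fin P → ℝ)) (x y : Fin P → ℝ) : ℝ≥0∞ :=
  ⨅ (γ : ℝ → (Fin P → ℝ)) (_ : IsCurve Λ x y γ), curveLength a γ

/-- `γ` is a shortest curve from `x` to `y`: a `C²` curve in `Λ` in arc length parametrization,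
defined on `[0, d]`, where `d` (hence its length) is the geodesic distance of `x` and `y`. -/
structure IsShortestCurve (a : (Fin P → ℝ) → H) (Λ : Set (Fin P → ℝ)) (x y : Fin P → ℝ)
    (d : ℝ) (γ : ℝ → (Fin P → ℝ)) : Prop where
  nonneg : 0 ≤ d
  dist_eq : geodesicDist a Λ x y = ENNReal.ofReal d
  mem : ∀ s ∈ Set.Icc 0 d, γ s ∈ Λ
  contDiffOn : ContDiffOn ℝ 2 γ (Set.Icc 0 d)
  unit_speed : ∀ s ∈ Set.Ioo 0 d, tangentNorm a (γ s) (deriv γ s) = 1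
  source : γ 0 = x
  target : γ d = y

/-- The density radius `sup_{x ∈ Λ} inf_{k ∈ Λd} d_G(x, k)` of `Λd` in `Λ`. -/
def densityRadius (a : (Fin P → ℝ) → H) (Λ Λd : Set (Fin P → ℝ)) : ℝ≥0∞ :=
  ⨆ x ∈ Λ, ⨅ k ∈ Λd, geodesicDist a Λ x k

/-- The score `S_u(x) = ⟨a_x, u⟩²`. -/
def score (a : (Fin P → ℝ) → H) (u : H) (x : Fin P → ℝ) : ℝ :=
  (inner ℝ (a x) u) ^ 2

/-- The greedy factor: `β² = inf_{u ∈ S, ‖u‖ = 1} sup_{x ∈ Λ} ⟨a_x, u⟩²`. -/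
def greedyFactor (a : (Fin P → ℝ) → H) (Λ : Set (Fin P → ℝ)) (S : Submodule ℝ H) : ℝ :=
  √(⨅ u : {u : H // u ∈ S ∧ ‖u‖ = 1}, ⨆ x : Λ, score a u x)

/-- The Riemannian gradient `∇^i S_u = G^{ij} ∂_j S_u`. -/
def gradScore (a : (Fin P → ℝ) → H) (u : H) (x : Fin P → ℝ) : Fin P → ℝ :=
  fun i => ∑ j, (metric a x)⁻¹ i j * pderiv j (score a u) x

/-- The gradient direction `|∇ S_u|⁻¹ ∇ S_u` (zero where the gradient vanishes). -/
def gradDirection (a : (Fin P → ℝ) → H) (u : H) (x : Fin P → ℝ) : Fin P → ℝ :=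
  (tangentNorm a x (gradScore a u x))⁻¹ • gradScore a u x

/-- Gradient ascent of `S_u` from `k` with step sizes `t`: `φ_{r+1} = φ_r + t_r ξ_r`. -/
def gradAscent (a : (Fin P → ℝ) → H) (u : H) (t : ℕ → ℝ) (k : Fin P → ℝ) : ℕ → (Fin P → ℝ)
  | 0 => k
  | r + 1 => gradAscent a u t k r + t r • gradDirection a u (gradAscent a u t k r)

/-- Step sizes are positive, keep the trajectory in `Λ` and never decrease the score. -/
structure IsAscentStepping (a : (Fin P → ℝ) → H) (Λ : Set (Fin P → ℝ)) (u : H)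
    (t : ℕ → ℝ) (k : Fin P → ℝ) : Prop where
  pos : ∀ r, 0 < t r
  mem : ∀ r, gradAscent a u t k r ∈ Λ
  ascent : ∀ r, score a u (gradAscent a u t k r) ≤ score a u (gradAscent a u t k (r + 1))

/-- `R` and `x` are the residuals and the selected parameters of a weak(`α`) matching pursuit
of `f` in the dictionary restricted to `Θ`. -/
structure IsMP (a : (Fin P → ℝ) → H) (Θ : Set (Fin P → ℝ)) (α : ℝ) (f : H)
    (R : ℕ → H) (x : ℕ → (Fin P → ℝ)) : Prop where
  init : R 0 = f
  mem : ∀ m, x (m + 1) ∈ Θ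
  select : ∀ m, α ^ 2 * (⨆ y : Θ, score a (R m) y) ≤ score a (R m) (x (m + 1))
  residual : ∀ m, R (m + 1) = R m - (inner ℝ (a (x (m + 1))) (R m)) • a (x (m + 1))

/-- `R` and `ν` are the residuals and the selected parameters of a geometrically optimized
matching pursuit of `f` with weakness factor `α`: at iteration `m` every seed `k ∈ Λd` is
optimized by `κ m` gradient ascent steps for the score of the residual `R m`, with step sizes
`t (R m) k`, and the parameter is selected among the optimized seeds. -/
structure IsGMP (a : (Fin P → ℝ) → H) (Λd : Set (Fin P → ℝ))
    (t : H → (Fin P → ℝ) → ℕ → ℝ) (κ : ℕ → ℕ) (α : ℝ) (f : H)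
    (R : ℕ → H) (ν : ℕ → (Fin P → ℝ)) : Prop where
  init : R 0 = f
  mem : ∀ m, ∃ k ∈ Λd, ν (m + 1) = gradAscent a (R m) (t (R m) k) k (κ m)
  select : ∀ m,
    α ^ 2 * (⨆ k : Λd, score a (R m) (gradAscent a (R m) (t (R m) k) k (κ m)))
      ≤ score a (R m) (ν (m + 1))
  residual : ∀ m, R (m + 1) = R m - (inner ℝ (a (ν (m + 1))) (R m)) • a (ν (m + 1))

/-- The weakness factor `α (1 - c β⁻² ρ² (1 + K))^{1/2}`: `c = 1` for the discrete matching
pursuit, `c = 1/2` for the optimized one. -/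
def weakness (c α β ρ K : ℝ) : ℝ :=
  α * √(1 - c * (β ^ 2)⁻¹ * ρ ^ 2 * (1 + K))

end GeomMP

end

namespace GeomMP

/-! The metric is the pull-back of the inner product of `H`, so an arc length curve `γ` in `Λ`
becomes a unit speed curve `c = a ∘ γ` on the unit sphere. Let `x` be a best parameter for the
residual `u`, and let `γ` be a shortest curve of length `d` from `x` to a seed. The score `F = ⟨c,
u⟩²` has `F'(0) = 0` and `F'' = 2⟨c', u⟩² + 2⟨c, u⟩⟨c'', u⟩`. On the sphere `⟨c, c''⟩ = -1`, which
together with `‖c''‖ ≤ K` gives `F'' ≥ -(1 + K)‖u‖²` (`neg_le_inner_mul_inner`). Hence the seed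
loses at most `(1 + K) d² ‖u‖² / 2`. Since `β²‖u‖² ≤ F(0)`, seeds at distance arbitrarily close to
`ρ` capture the proportion `1 - β⁻² ρ² (1 + K) / 2` of the best score, up to an arbitrarily small
error. Gradient ascent never lowers a score, so this survives any number of steps.

The bound `‖c''‖ ≤ K` is not immediate: `K` only controls solutions of the geodesic equation, while
the given curves are merely shortest. A first variation argument
(`IsShortestCurve.inner_acceleration_nonpos`) shows that `c''` is orthogonal to the tangent space,
and this orthogonality is the geodesic equation in coordinates.

Finally, a step that captures a proportion `q` of the energy multiplies `‖R‖²` by at most `1 - q`.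
-/

variable {P : ℕ} {H : Type*} [NormedAddCommGroup H] [InnerProductSpace ℝ H]
  {a : (Fin P → ℝ) → H} {Λ : Set (Fin P → ℝ)}

/-! ### The induced metric, its Christoffel symbols and the geodesic equation -/

/-- The differential of `a` in terms of its partial derivatives. -/
theorem sum_smul_pderiv {F : Type*} [NormedAddCommGroup F] [NormedSpace ℝ F]
    (h : (Fin P → ℝ) → F) (x ξ : Fin P → ℝ) :
    ∑ i, ξ i • pderiv i h x = fderiv ℝ h x ξ := by
  conv_rhs => rw [pi_eq_sum_univ' ξ]
  rw [map_sum]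
  refine Finset.sum_congr rfl fun i _ => ?_
  rw [pderiv, ← map_smul]

theorem sum_sum_metric (a : (Fin P → ℝ) → H) (x ξ : Fin P → ℝ) :
    ∑ i, ∑ j, ξ i * ξ j * metric a x i j = ‖fderiv ℝ a x ξ‖ ^ 2 := by
  rw [← real_inner_self_eq_norm_sq, ← sum_smul_pderiv, sum_inner]
  refine Finset.sum_congr rfl fun i _ => ?_
  rw [inner_sum]
  refine Finset.sum_congr rfl fun j _ => ?_
  rw [real_inner_smul_left, real_inner_smul_right, metric, Matrix.of_apply]
  ring

theorem tangentNorm_eq_norm_fderiv (a : (Fin P → ℝ) → H) (x ξ : Fin P → ℝ) :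
    tangentNorm a x ξ = ‖fderiv ℝ a x ξ‖ := by
  rw [tangentNorm, sum_sum_metric, Real.sqrt_sq (norm_nonneg _)]

theorem differentiableAt_fderiv {x : Fin P → ℝ} (ha : ContDiffAt ℝ 2 a x) :
    DifferentiableAt ℝ (fderiv ℝ a) x :=
  (ha.fderiv_right (m := 1) (by norm_num)).differentiableAt (by norm_num)

theorem fderiv_fderiv_symm {x : Fin P → ℝ} (ha : ContDiffAt ℝ 2 a x) (v w : Fin P → ℝ) :
    fderiv ℝ (fderiv ℝ a) x v w = fderiv ℝ (fderiv ℝ a) x w v :=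
  (ha.isSymmSndFDerivAt (by simp)) v w

theorem pderiv_metric {x : Fin P → ℝ} (ha : ContDiffAt ℝ 2 a x) (i j l : Fin P) :
    pderiv l (fun y => metric a y i j) x =
      inner ℝ (fderiv ℝ (fderiv ℝ a) x (Pi.single l 1) (Pi.single i 1)) (pderiv j a x) +
      inner ℝ (pderiv i a x) (fderiv ℝ (fderiv ℝ a) x (Pi.single l 1) (Pi.single j 1)) := by
  have h : ∀ i : Fin P, HasFDerivAt (fun y => pderiv i a y)
      ((fderiv ℝ (fderiv ℝ a) x).flip (Pi.single i 1)) x := fun i =>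
    ((ContinuousLinearMap.apply ℝ H (Pi.single i 1 : Fin P → ℝ)).hasFDerivAt.comp x
      (differentiableAt_fderiv ha).hasFDerivAt).congr_fderiv (by ext; rfl)
  have h2 := ((h i).inner ℝ (h j)).fderiv
  rw [pderiv]
  simp only [metric, Matrix.of_apply]
  rw [h2]
  simp [fderivInnerCLM_apply, add_comm]

/-- By symmetry of second derivatives, four of the six terms in the derivatives of the metric cancel
and the other two coincide. -/
theorem christoffel_eq {x : Fin P → ℝ} (ha : ContDiffAt ℝ 2 a x) (k i j : Fin P) :
    christoffel a k i j x = ∑ l, (metric a x)⁻¹ k l *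
      inner ℝ (fderiv ℝ (fderiv ℝ a) x (Pi.single i 1) (Pi.single j 1)) (pderiv l a x) := by
  rw [christoffel, Finset.mul_sum]
  refine Finset.sum_congr rfl fun l _ => ?_
  rw [pderiv_metric ha, pderiv_metric ha, pderiv_metric ha,
    fderiv_fderiv_symm ha (Pi.single j 1) (Pi.single l 1),
    fderiv_fderiv_symm ha (Pi.single j 1) (Pi.single i 1),
    fderiv_fderiv_symm ha (Pi.single i 1) (Pi.single l 1),
    real_inner_comm (pderiv j a x), real_inner_comm (pderiv l a x),
    real_inner_comm (pderiv i a x)]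
  ring

theorem sum_christoffel {x : Fin P → ℝ} (ha : ContDiffAt ℝ 2 a x) (k : Fin P) (v : Fin P → ℝ) :
    ∑ i, ∑ j, christoffel a k i j x * v i * v j =
      ∑ l, (metric a x)⁻¹ k l * inner ℝ (fderiv ℝ (fderiv ℝ a) x v v) (pderiv l a x) := by
  have hv : fderiv ℝ (fderiv ℝ a) x v v =
      ∑ i, ∑ j, (v i * v j) • fderiv ℝ (fderiv ℝ a) x (Pi.single i 1) (Pi.single j 1) := by
    have h1 : v = ∑ i, v i • (Pi.single i 1 : Fin P → ℝ) := by
      ext j; simp [Finset.sum_apply, Pi.single_apply]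
    conv_lhs => rw [h1]
    simp only [map_sum, map_smul, sum_apply, smul_apply,
      Finset.smul_sum, smul_smul]
    rw [Finset.sum_comm]
    simp only [mul_comm]
  simp only [hv, sum_inner, real_inner_smul_left, Finset.mul_sum, christoffel_eq ha,
    Finset.sum_mul]
  rw [Finset.sum_comm' (t' := Finset.univ) (s' := fun _ => Finset.univ) (by simp)]
  conv_lhs =>
    enter [2, j]
    rw [Finset.sum_comm]
  rw [Finset.sum_comm]
  refine Finset.sum_congr rfl fun l _ => ?_
  rw [Finset.sum_comm]
  refine Finset.sum_congr rfl fun i _ => Finset.sum_congr rfl fun j _ => ?_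
  ring

/-- If the acceleration of a curve in `H` is orthogonal to the tangent space, its parameters
satisfy the geodesic equation. -/
theorem geodesic_equation_of_normal {x : Fin P → ℝ} (ha : ContDiffAt ℝ 2 a x)
    (hG : (metric a x).PosDef) (v z : Fin P → ℝ)
    (hn : ∀ w, inner ℝ (fderiv ℝ (fderiv ℝ a) x v v + fderiv ℝ a x z) (fderiv ℝ a x w) = 0)
    (k : Fin P) : z k + ∑ i, ∑ j, christoffel a k i j x * v i * v j = 0 := by
  -- Testing normality against the coordinate vectors shows that the tangential part of `D²a(v, v)`
  -- cancels `Da z`; multiplying by the inverse metric then recovers `z`.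
  have h1 : ∀ l, inner ℝ (fderiv ℝ (fderiv ℝ a) x v v) (pderiv l a x) =
      -(metric a x *ᵥ z) l := by
    intro l
    have := hn (Pi.single l 1)
    rw [inner_add_left, ← sum_smul_pderiv a x z, sum_inner] at this
    simp only [Matrix.mulVec, dotProduct, metric, Matrix.of_apply]
    rw [pderiv, eq_neg_of_add_eq_zero_left this]
    congr 1
    refine Finset.sum_congr rfl fun i _ => ?_
    rw [real_inner_smul_left, real_inner_comm, mul_comm]
  have h2 : (metric a x)⁻¹ *ᵥ (metric a x *ᵥ z) = z := by
    rw [Matrix.mulVec_mulVec, Matrix.nonsing_inv_mul _ ((Matrix.isUnit_iff_isUnit_det _).1 hG.isUnit),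
      Matrix.one_mulVec]
  rw [sum_christoffel ha]
  simp only [h1, mul_neg, Finset.sum_neg_distrib]
  have := congrFun h2 k
  rw [Matrix.mulVec, dotProduct] at this
  rw [this]; ring

/-! ### Length comparison and first variation -/

/-- A `C¹` curve on `[0, d]` bounds the geodesic distance of its end points by the increase of any
function whose derivative bounds its speed. -/
theorem geodesicDist_le (hΛ : IsOpen Λ) (ha : ContDiffOn ℝ 2 a Λ) {d : ℝ} (hd : 0 < d)
    {γ : ℝ → (Fin P → ℝ)} (hmem : ∀ s ∈ Set.Icc 0 d, γ s ∈ Λ)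
    (hγ : ContDiffOn ℝ 1 γ (Set.Icc 0 d)) {Φ Φ' : ℝ → ℝ} (hΦ : ContinuousOn Φ (Set.Icc 0 d))
    (hΦ' : ∀ s ∈ Set.Ioo 0 d, HasDerivAt Φ (Φ' s) s)
    (hle : ∀ s ∈ Set.Ioo 0 d, ‖fderiv ℝ a (γ s) (deriv γ s)‖ ≤ Φ' s) :
    geodesicDist a Λ (γ 0) (γ d) ≤ ENNReal.ofReal (Φ d - Φ 0) := by
  have hmaps : Set.MapsTo (fun t => d * t) (Set.Icc (0 : ℝ) 1) (Set.Icc 0 d) := fun t ht =>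
    ⟨mul_nonneg hd.le ht.1, by nlinarith [ht.2]⟩
  have hlin : ContDiff ℝ 1 fun t : ℝ => d * t := by fun_prop
  have hσ : ContDiffOn ℝ 1 (fun t => γ (d * t)) (Set.Icc 0 1) := hγ.comp hlin.contDiffOn hmaps
  have hcurve : IsCurve Λ (γ 0) (γ d) fun t => γ (d * t) :=
    ⟨fun t ht => hmem _ (hmaps ht), hσ, by simp, by simp⟩
  have hw : ContDiffOn ℝ 1 (fun t => a (γ (d * t))) (Set.Icc 0 1) :=
    (ha.of_le (by norm_num)).comp hσ fun t ht => hmem _ (hmaps ht)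
  have hcont := hw.continuousOn_derivWithin (uniqueDiffOn_Icc one_pos) le_rfl
  have hint : MeasureTheory.IntegrableOn (derivWithin (fun t => a (γ (d * t))) (Set.Icc 0 1))
      (Set.Icc 0 1) := hcont.integrableOn_Icc
  refine (iInf₂_le (fun t => γ (d * t)) hcurve).trans ?_
  rw [curveLength, ← MeasureTheory.ofReal_integral_norm_eq_lintegral_enorm hint]
  refine ENNReal.ofReal_le_ofReal ?_
  rw [MeasureTheory.integral_Icc_eq_integral_Ioc, ← intervalIntegral.integral_of_le zero_le_one]
  -- This form of the fundamental theorem needs no integrability of `Φ'`, only of the speed it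
  -- dominates.
  have key := intervalIntegral.integral_le_sub_of_hasDeriv_right_of_le (a := 0) (b := 1)
    (g := fun t => Φ (d * t)) (g' := fun t => Φ' (d * t) * d)
    (φ := fun t => ‖derivWithin (fun t => a (γ (d * t))) (Set.Icc 0 1) t‖)
    zero_le_one (hΦ.comp hlin.continuous.continuousOn hmaps) ?_ hint.norm ?_
  · simpa using key
  all_goals
    intro t ht
    have hs : d * t ∈ Set.Ioo 0 d := ⟨mul_pos hd ht.1, by nlinarith [ht.2]⟩
    have hl : HasDerivAt (fun t => d * t) d t := by simpa using (hasDerivAt_id t).const_mul d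
  · exact ((hΦ' _ hs).comp t hl).hasDerivWithinAt
  · have hγd : HasDerivAt γ (deriv γ (d * t)) (d * t) :=
      ((hγ.contDiffAt (Icc_mem_nhds hs.1 hs.2)).differentiableAt (by norm_num)).hasDerivAt
    have hm := hmem _ (Set.Ioo_subset_Icc_self hs)
    have had : HasFDerivAt a (fderiv ℝ a (γ (d * t))) (γ (d * t)) :=
      ((ha.contDiffAt (hΛ.mem_nhds hm)).differentiableAt (by norm_num)).hasFDerivAt
    have h1 := had.comp_hasDerivAt t (hγd.scomp t hl)
    have h2 : derivWithin (fun t => a (γ (d * t))) (Set.Icc 0 1) t =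
        fderiv ℝ a (γ (d * t)) (d • deriv γ (d * t)) := by
      rw [derivWithin_of_mem_nhds (Icc_mem_nhds ht.1 ht.2)]
      exact h1.deriv
    rw [h2, map_smul, norm_smul, Real.norm_of_nonneg hd.le, mul_comm]
    exact mul_le_mul_of_nonneg_right (hle _ hs) hd.le

theorem hasDerivAt_comp_curve {γ : ℝ → (Fin P → ℝ)} {s : ℝ} {γ' : Fin P → ℝ}
    (ha : ContDiffAt ℝ 2 a (γ s)) (hγ : HasDerivAt γ γ' s) :
    HasDerivAt (fun r => a (γ r)) (fderiv ℝ a (γ s) γ') s :=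
  (ha.differentiableAt (by norm_num)).hasFDerivAt.comp_hasDerivAt s hγ

theorem deriv_comp_curve_eventuallyEq {γ : ℝ → (Fin P → ℝ)} {s : ℝ}
    (ha : ContDiffAt ℝ 2 a (γ s)) (hγ : ContDiffAt ℝ 2 γ s) :
    deriv (fun r => a (γ r)) =ᶠ[nhds s] fun r => fderiv ℝ a (γ r) (deriv γ r) := by
  filter_upwards [hγ.eventually (by simp), hγ.continuousAt.eventually (ha.eventually (by simp))]
    with r hr har
  exact (hasDerivAt_comp_curve har (hr.differentiableAt (by norm_num)).hasDerivAt).deriv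

theorem contDiffAt_deriv {F : Type*} [NormedAddCommGroup F] [NormedSpace ℝ F] {γ : ℝ → F} {s : ℝ}
    (hγ : ContDiffAt ℝ 2 γ s) : ContDiffAt ℝ 1 (deriv γ) s := by
  have h : deriv γ = fun r => fderiv ℝ γ r 1 := by ext r; simp
  rw [h]
  exact (hγ.fderiv_right (m := 1) (by norm_num)).clm_apply contDiffAt_const

theorem deriv_deriv_comp_curve {γ : ℝ → (Fin P → ℝ)} {s : ℝ}
    (ha : ContDiffAt ℝ 2 a (γ s)) (hγ : ContDiffAt ℝ 2 γ s) :
    deriv (deriv fun r => a (γ r)) s =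
      fderiv ℝ (fderiv ℝ a) (γ s) (deriv γ s) (deriv γ s) +
        fderiv ℝ a (γ s) (deriv (deriv γ) s) := by
  rw [(deriv_comp_curve_eventuallyEq ha hγ).deriv_eq]
  have h1 : HasDerivAt (fun r => fderiv ℝ a (γ r))
      (fderiv ℝ (fderiv ℝ a) (γ s) (deriv γ s)) s :=
    (differentiableAt_fderiv ha).hasFDerivAt.comp_hasDerivAt s
      (hγ.differentiableAt (by norm_num)).hasDerivAt
  exact (h1.clm_apply ((contDiffAt_deriv hγ).differentiableAt (by norm_num)).hasDerivAt).deriv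

/-- Pointwise first variation: `c'` is the velocity of a unit speed curve and `δ` the displacement
under a perturbation of size `ε b` in the direction `e`. The square root in the speed is removed by
`n ≤ (1 + n²)/2`, which is sharp to first order at `n = 1`. The bracket is the derivative of `⟨c',
δ⟩`, so it integrates to boundary terms; the gain `ε q b` comes from `⟨c'', δ⟩`. -/
theorem norm_add_le_of_first_order {c' c'' δ δ' e : H} {ε b q N C₁ C₂ : ℝ} (hc : ‖c'‖ = 1)
    (hN : ‖c''‖ ≤ N) (hδ' : ‖δ'‖ ≤ ε * C₁) (hδ : ‖δ - (ε * b) • e‖ ≤ ε ^ 2 * C₂)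
    (hb : b ≠ 0 → q ≤ inner ℝ c'' e) (hεb : 0 ≤ ε * b) :
    ‖c' + δ'‖ ≤ 1 + (inner ℝ c' δ' + inner ℝ c'' δ) - ε * q * b +
      ε ^ 2 * (C₁ ^ 2 / 2 + N * C₂) := by
  have h1 : ‖c' + δ'‖ ^ 2 = 1 + 2 * inner ℝ c' δ' + ‖δ'‖ ^ 2 := by
    rw [norm_add_sq_real, hc]; ring
  have h2 : ‖c' + δ'‖ ≤ (1 + ‖c' + δ'‖ ^ 2) / 2 := by nlinarith [sq_nonneg (‖c' + δ'‖ - 1)]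
  have h3 : ‖δ'‖ ^ 2 ≤ ε ^ 2 * C₁ ^ 2 := by
    rw [← mul_pow]; exact pow_le_pow_left₀ (norm_nonneg _) hδ' 2
  have h4 : inner ℝ c'' δ = (ε * b) * inner ℝ c'' e + inner ℝ c'' (δ - (ε * b) • e) := by
    rw [inner_sub_right, real_inner_smul_right]; ring
  have h5 : -(ε ^ 2 * (N * C₂)) ≤ inner ℝ c'' (δ - (ε * b) • e) := by
    have := (abs_le.1 (abs_real_inner_le_norm c'' (δ - (ε * b) • e))).1
    have h6 : ‖c''‖ * ‖δ - (ε * b) • e‖ ≤ N * (ε ^ 2 * C₂) :=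
      mul_le_mul hN hδ (norm_nonneg _) ((norm_nonneg _).trans hN)
    linarith
  have h6 : ε * q * b ≤ (ε * b) * inner ℝ c'' e := by
    rcases eq_or_ne b 0 with rfl | h
    · simp
    · nlinarith [mul_le_mul_of_nonneg_left (hb h) hεb]
  linarith

/-- First variation of the length: the acceleration of a shortest curve in `H` is normal. -/
theorem IsShortestCurve.inner_acceleration_nonpos (hΛ : IsOpen Λ) (ha : ContDiffOn ℝ 2 a Λ)
    {x y : Fin P → ℝ} {d : ℝ} {γ : ℝ → (Fin P → ℝ)} (hγ : IsShortestCurve a Λ x y d γ)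
    {s₀ : ℝ} (hs₀ : s₀ ∈ Set.Ioo 0 d) (v : Fin P → ℝ) :
    inner ℝ (deriv (deriv fun r => a (γ r)) s₀) (fderiv ℝ a (γ s₀) v) ≤ 0 := by
  by_contra! hq
  have hd : 0 < d := hs₀.1.trans hs₀.2
  have hmem : ∀ s ∈ Set.Ioo 0 d, γ s ∈ Λ := fun s hs => hγ.mem s (Set.Ioo_subset_Icc_self hs)
  have haΛ : ∀ z ∈ Λ, ContDiffAt ℝ 2 a z := fun z hz => ha.contDiffAt (hΛ.mem_nhds hz)
  have hγs : ∀ s ∈ Set.Ioo 0 d, ContDiffAt ℝ 2 γ s := fun s hs =>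
    hγ.contDiffOn.contDiffAt (Icc_mem_nhds hs.1 hs.2)
  have hcs : ∀ s ∈ Set.Ioo 0 d, ContDiffAt ℝ 2 (fun r => a (γ r)) s := fun s hs =>
    (haΛ _ (hmem s hs)).comp s (hγs s hs)
  have hA := (haΛ _ (hmem s₀ hs₀)).fderiv_right (m := 1) (by norm_num)
  -- a ball around `γ s₀` with uniform bounds
  obtain ⟨L, T, hT, hL⟩ := hA.exists_lipschitzOnWith
  obtain ⟨M, hM⟩ : ∃ M, M = ‖fderiv ℝ a (γ s₀)‖ + 1 := ⟨_, rfl⟩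
  obtain ⟨ρ, hρ, hball⟩ := Metric.eventually_nhds_iff_ball.1
    ((Filter.eventually_mem_set.2 hT).and ((hΛ.eventually_mem (hmem s₀ hs₀)).and
      (hA.continuousAt.norm.eventually (eventually_le_nhds (b := M) (by linarith)))))
  set c'' := deriv (deriv fun r => a (γ r)) with hc''
  -- Half of the assumed positive value, so that the lower bound persists near `s₀`.
  obtain ⟨q, hq0⟩ : ∃ q, q = inner ℝ (c'' s₀) (fderiv ℝ a (γ s₀) v) / 2 := ⟨_, rfl⟩
  have hqpos : 0 < q := by linarith
  have hc''c : ContinuousAt c'' s₀ := by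
    have h1 := contDiffAt_deriv (hcs s₀ hs₀)
    have h2 : c'' = fun r => fderiv ℝ (deriv fun r => a (γ r)) r 1 := by
      ext r; simp [hc'']
    rw [h2]
    exact (h1.continuousAt_fderiv (by norm_num)).clm_apply continuousAt_const
  have hev : ∀ᶠ s in nhds s₀, γ s ∈ Metric.ball (γ s₀) (ρ / 2) ∧ s ∈ Set.Ioo 0 d ∧
      ‖deriv γ s‖ ≤ ‖deriv γ s₀‖ + 1 ∧ ‖c'' s‖ ≤ ‖c'' s₀‖ + 1 ∧
      q ≤ inner ℝ (c'' s) (fderiv ℝ a (γ s) v) := by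
    have hγc := (hγs s₀ hs₀).continuousAt
    have hAv : ContinuousAt (fun s => fderiv ℝ a (γ s) v) s₀ :=
      (ContinuousAt.comp (f := γ) hA.continuousAt hγc).clm_apply continuousAt_const
    refine (hγc.eventually_mem (Metric.ball_mem_nhds _ (by positivity))).and
      ((isOpen_Ioo.eventually_mem hs₀).and ?_)
    refine ((contDiffAt_deriv (hγs s₀ hs₀)).continuousAt.norm.eventually
      (eventually_le_nhds (lt_add_one _))).and
      ((hc''c.norm.eventually (eventually_le_nhds (lt_add_one _))).and ?_)
    exact (hc''c.inner hAv).eventually (eventually_ge_nhds (by linarith))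
  obtain ⟨r, hr, hrball⟩ := Metric.nhds_basis_closedBall.eventually_iff.1 hev
  -- the bump function
  let b : ContDiffBump s₀ := ⟨r / 2, r, by positivity, by linarith⟩
  have hbd : ContDiff ℝ 2 b := b.contDiff (n := 2)
  have hb0 : ∀ s, r ≤ dist s s₀ → b s = 0 := fun s hs => b.zero_of_le_dist hs
  -- The bump is nonnegative, so each zero is a minimum.
  have hb0' : ∀ s, b s = 0 → deriv b s = 0 := fun s hs =>
    IsLocalMin.deriv_eq_zero (Filter.Eventually.of_forall fun z => by rw [hs]; exact b.nonneg)
  obtain ⟨N₂, hN₂⟩ := b.hasCompactSupport.deriv.exists_bound_of_continuous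
    (hbd.continuous_deriv (by norm_num))
  have hbv : ∀ s ∈ Set.Ioo 0 d, b s ≠ 0 → s ∈ Metric.closedBall s₀ r := fun s _ h => by
    by_contra h'
    exact h (hb0 s (not_le.1 h').le)
  obtain ⟨Q, hQ⟩ : ∃ Q : ℝ → ℝ, Q = fun s => ∫ z in (0 : ℝ)..s, b z := ⟨_, rfl⟩
  have hQ' : ∀ s, HasDerivAt Q (b s) s := fun s => by
    rw [hQ]
    exact intervalIntegral.integral_hasDerivAt_right (b.continuous.intervalIntegrable _ _)
      (b.continuous.stronglyMeasurableAtFilter _ _) b.continuous.continuousAt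
  have hQ0 : Q 0 = 0 := by simp [hQ]
  have hQd : 0 < Q d := by
    rw [hQ]
    refine intervalIntegral.integral_pos hd b.continuous.continuousOn (fun z _ => b.nonneg)
      ⟨s₀, Set.Ioo_subset_Icc_self hs₀, ?_⟩
    exact b.pos_of_mem_ball (Metric.mem_ball_self hr)
  -- comparison with the perturbed curve
  obtain ⟨C₁, hC₁⟩ : ∃ C, C = L * ‖v‖ * (‖deriv γ s₀‖ + 1) + M * (N₂ * ‖v‖) := ⟨_, rfl⟩
  obtain ⟨C, hC⟩ : ∃ C, C = C₁ ^ 2 / 2 + (‖c'' s₀‖ + 1) * (L * ‖v‖ ^ 2) := ⟨_, rfl⟩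
  have hC0 : 0 ≤ C := by rw [hC]; positivity
  -- The perturbed curve has length at most `d - ε q Q(d) + ε² C d`, which cannot be less than the
  -- distance `d`. Letting `ε` tend to `0` contradicts `q Q(d) > 0`.
  have hmain : ∀ ε : ℝ, 0 < ε → ε * ‖v‖ < ρ / 2 → q * Q d ≤ ε * (C * d) := by
    intro ε hε hεv
    obtain ⟨η, hη⟩ : ∃ η : ℝ → (Fin P → ℝ), η = fun s => γ s + (ε * b s) • v := ⟨_, rfl⟩
    have hηb : ∀ s, b s = 0 → η s = γ s := fun s h => by rw [hη]; simp [h]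
    have hnear : ∀ s ∈ Metric.closedBall s₀ r, γ s ∈ Metric.ball (γ s₀) ρ ∧
        η s ∈ Metric.ball (γ s₀) ρ := by
      intro s hs
      have h1 := (hrball hs).1
      refine ⟨Metric.ball_subset_ball (by linarith) h1, ?_⟩
      have h2 : dist (η s) (γ s) ≤ ε * ‖v‖ := by
        rw [hη, dist_eq_norm, add_sub_cancel_left, norm_smul, norm_mul, Real.norm_of_nonneg hε.le,
          Real.norm_of_nonneg b.nonneg]
        have := b.le_one (x := s)
        gcongr
        nlinarith
      rw [Metric.mem_ball] at h1 ⊢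
      linarith [dist_triangle (η s) (γ s) (γ s₀)]
    have hηmem : ∀ s ∈ Set.Icc 0 d, η s ∈ Λ := by
      intro s hs
      by_cases h : s ∈ Metric.closedBall s₀ r
      · exact (hball _ (hnear s h).2).2.1
      · rw [hηb s (hb0 s (not_le.1 h).le)]
        exact hγ.mem s hs
    have hηd : ∀ s ∈ Set.Ioo 0 d, HasDerivAt η (deriv γ s + (ε * deriv b s) • v) s := by
      intro s hs
      rw [hη]
      exact ((hγs s hs).differentiableAt (by norm_num)).hasDerivAt.add
        (((hbd.differentiable (by norm_num) s).hasDerivAt.const_mul ε).smul_const v)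
    have hηC : ContDiffOn ℝ 1 η (Set.Icc 0 d) := by
      rw [hη]
      refine (hγ.contDiffOn.of_le (by norm_num)).add ?_
      exact ((contDiff_const.mul (hbd.of_le (by norm_num))).smul contDiff_const).contDiffOn
    obtain ⟨p, hp⟩ : ∃ p : ℝ → ℝ, p = fun s => inner ℝ (deriv (fun r => a (γ r)) s)
        (a (η s) - a (γ s)) := ⟨_, rfl⟩
    have hp0 : ∀ s, b s = 0 → p s = 0 := fun s h => by rw [hp]; simp [hηb s h]
    have hpd : ∀ s ∈ Set.Ioo 0 d, HasDerivAt p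
        (inner ℝ (fderiv ℝ a (γ s) (deriv γ s))
          (fderiv ℝ a (η s) (deriv η s) - fderiv ℝ a (γ s) (deriv γ s)) +
          inner ℝ (c'' s) (a (η s) - a (γ s))) s := by
      intro s hs
      have h1 : HasDerivAt (deriv fun r => a (γ r)) (c'' s) s :=
        ((contDiffAt_deriv (hcs s hs)).differentiableAt (by norm_num)).hasDerivAt
      have h2 := hasDerivAt_comp_curve (haΛ _ (hmem s hs))
        ((hγs s hs).differentiableAt (by norm_num)).hasDerivAt
      have h3 := hasDerivAt_comp_curve (haΛ _ (hηmem s (Set.Ioo_subset_Icc_self hs)))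
        (hηd s hs).differentiableAt.hasDerivAt
      have := h1.inner ℝ (h3.sub h2)
      rw [h2.deriv] at this
      rw [hp]
      exact this
    -- At `0` and `d` the derivative of `a ∘ γ` may be a default value; it does no harm, because the
    -- closed ball lies in `(0, d)` and `p` vanishes outside it.
    have hpc : Continuous p := by
      refine continuous_iff_continuousAt.2 fun s => ?_
      by_cases h : s ∈ Metric.closedBall s₀ r
      · exact (hpd s (hrball h).2.1).continuousAt
      · have : p =ᶠ[nhds s] fun _ => 0 := by
          filter_upwards [Metric.isClosed_closedBall.isOpen_compl.mem_nhds h] with z hz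
          exact hp0 z (hb0 z (not_le.1 (Set.notMem_of_mem_compl hz)).le)
        exact continuousAt_const.congr this.symm
    have hQc : Continuous Q := continuous_iff_continuousAt.2 fun s => (hQ' s).continuousAt
    have hdist := geodesicDist_le hΛ ha hd hηmem hηC
      (Φ := fun s => s + p s - ε * q * Q s + ε ^ 2 * C * s)
      (Φ' := fun s => 1 + (inner ℝ (fderiv ℝ a (γ s) (deriv γ s))
          (fderiv ℝ a (η s) (deriv η s) - fderiv ℝ a (γ s) (deriv γ s)) +
          inner ℝ (c'' s) (a (η s) - a (γ s))) - ε * q * b s + ε ^ 2 * C)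
      (by fun_prop) ?_ ?_
    · have hb00 : b 0 = 0 := by
        by_contra h
        have := (hrball (x := 0) (by by_contra h'; exact h (hb0 0 (not_le.1 h').le))).2.1
        exact lt_irrefl _ this.1
      have hbd0 : b d = 0 := by
        by_contra h
        have := (hrball (x := d) (by by_contra h'; exact h (hb0 d (not_le.1 h').le))).2.1
        exact lt_irrefl _ this.2
      rw [hηb 0 hb00, hηb d hbd0, hγ.source, hγ.target, hγ.dist_eq, hp0 0 hb00, hp0 d hbd0, hQ0,
        ENNReal.ofReal_le_ofReal_iff'] at hdist
      rcases hdist with h | h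
      · have : ε * (q * Q d) ≤ ε * (ε * (C * d)) := by linarith
        exact le_of_mul_le_mul_left this hε
      · linarith
    · intro s hs
      have h1 := (((hasDerivAt_id s).add (hpd s hs)).sub ((hQ' s).const_mul (ε * q))).add
        ((hasDerivAt_id s).const_mul (ε ^ 2 * C))
      rw [mul_one] at h1
      exact h1
    · intro s hs
      have hunit : ‖fderiv ℝ a (γ s) (deriv γ s)‖ = 1 := by
        rw [← tangentNorm_eq_norm_fderiv]; exact hγ.unit_speed s hs
      have hbn : 0 ≤ b s := b.nonneg
      by_cases h : b s = 0
      · have h1 : deriv η s = deriv γ s := by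
          rw [(hηd s hs).deriv, hb0' s h]; simp
        rw [h1, hηb s h, hunit, h]
        simp only [sub_self, inner_zero_right]
        nlinarith [mul_nonneg (sq_nonneg ε) hC0]
      · have hsb := hbv s hs h
        obtain ⟨-, -, hγ', hcn, hqs⟩ := hrball hsb
        obtain ⟨hγb, hηball⟩ := hnear s hsb
        have hηγ : η s - γ s = (ε * b s) • v := by rw [hη]; simp
        have hεb : ‖ε * b s‖ ≤ ε := by
          rw [norm_mul, Real.norm_of_nonneg hε.le, Real.norm_of_nonneg hbn]
          nlinarith [b.le_one (x := s)]
        have hηn : ‖η s - γ s‖ ≤ ε * ‖v‖ := by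
          rw [hηγ, norm_smul]; gcongr
        have hlip : ∀ z ∈ segment ℝ (γ s) (η s), ‖fderiv ℝ a z - fderiv ℝ a (γ s)‖ ≤
            L * (ε * ‖v‖) := by
          intro z hz
          have hzb := (convex_ball (γ s₀) ρ).segment_subset hγb hηball hz
          have h1 := hL.norm_sub_le (hball z hzb).1 (hball _ hγb).1
          have h2 : ‖z - γ s‖ ≤ ‖η s - γ s‖ := by
            rw [segment_eq_image'] at hz
            obtain ⟨θ, hθ, rfl⟩ := hz
            rw [add_sub_cancel_left, norm_smul, Real.norm_of_nonneg hθ.1]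
            exact mul_le_of_le_one_left (norm_nonneg _) hθ.2
          exact h1.trans (mul_le_mul_of_nonneg_left (h2.trans hηn) L.2)
        have hsum : fderiv ℝ a (η s) (deriv η s) = fderiv ℝ a (γ s) (deriv γ s) +
            (fderiv ℝ a (η s) (deriv η s) - fderiv ℝ a (γ s) (deriv γ s)) := by abel
        conv_lhs => rw [hsum]
        rw [hC]
        refine norm_add_le_of_first_order (e := fderiv ℝ a (γ s) v) hunit hcn ?_ ?_
          (fun _ => hqs) (by positivity)
        -- The change of velocity is of order `ε`: one part from moving the base point, one from the
        -- derivative of the bump.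
        · have h1 : fderiv ℝ a (η s) (deriv η s) - fderiv ℝ a (γ s) (deriv γ s) =
              (fderiv ℝ a (η s) - fderiv ℝ a (γ s)) (deriv γ s) +
                fderiv ℝ a (η s) ((ε * deriv b s) • v) := by
            rw [(hηd s hs).deriv, map_add, sub_apply]; abel
          rw [h1, hC₁]
          have h2 : ‖(fderiv ℝ a (η s) - fderiv ℝ a (γ s)) (deriv γ s)‖ ≤
              L * (ε * ‖v‖) * (‖deriv γ s₀‖ + 1) :=
            (ContinuousLinearMap.le_opNorm _ _).trans
              (mul_le_mul (hlip _ (right_mem_segment ℝ _ _)) hγ' (norm_nonneg _) (by positivity))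
          have h3 : ‖fderiv ℝ a (η s) ((ε * deriv b s) • v)‖ ≤ M * (ε * (N₂ * ‖v‖)) := by
            refine (ContinuousLinearMap.le_opNorm _ _).trans
              (mul_le_mul (hball _ hηball).2.2 ?_ (norm_nonneg _) (by rw [hM]; positivity))
            rw [norm_smul, norm_mul, Real.norm_of_nonneg hε.le, mul_assoc]
            have := hN₂ s
            gcongr
          refine (norm_add_le _ _).trans ((add_le_add h2 h3).trans (le_of_eq ?_))
          ring
        -- The mean value inequality with the Lipschitz bound on `Da` makes the error of the
        -- linearized displacement quadratic in `ε`.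
        · have h1 := Convex.norm_image_sub_le_of_norm_hasFDerivWithin_le' (f := a)
            (f' := fderiv ℝ a) (φ := fderiv ℝ a (γ s)) (fun z hz =>
              ((haΛ z (hball z ((convex_ball (γ s₀) ρ).segment_subset hγb hηball hz)).2.1
                ).differentiableAt (by norm_num)).hasFDerivAt.hasFDerivWithinAt) hlip
            (convex_segment _ _) (left_mem_segment ℝ _ _) (right_mem_segment ℝ _ _)
          rw [hηγ, map_smul, ← hηγ] at h1
          refine h1.trans ((mul_le_mul_of_nonneg_left hηn (by positivity)).trans (le_of_eq ?_))
          ring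
  obtain ⟨ε, hε, hε1, hε2⟩ : ∃ ε : ℝ, 0 < ε ∧ ε * ‖v‖ < ρ / 2 ∧ ε * (C * d) < q * Q d := by
    have h1 : Filter.Tendsto (fun ε : ℝ => ε * ‖v‖) (nhds 0) (nhds 0) := by
      simpa using (continuous_mul_const ‖v‖).tendsto (0 : ℝ)
    have h2 : Filter.Tendsto (fun ε : ℝ => ε * (C * d)) (nhds 0) (nhds 0) := by
      simpa using (continuous_mul_const (C * d)).tendsto (0 : ℝ)
    have h3 := ((h1.eventually (eventually_lt_nhds (half_pos hρ))).and
      (h2.eventually (eventually_lt_nhds (mul_pos hqpos hQd)))).filter_mono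
      (nhdsWithin_le_nhds (s := Set.Ioi 0))
    obtain ⟨ε, h, hε⟩ := (h3.and self_mem_nhdsWithin).exists
    exact ⟨ε, hε, h⟩
  linarith [hmain ε hε hε1]

theorem IsShortestCurve.inner_acceleration_eq_zero (hΛ : IsOpen Λ) (ha : ContDiffOn ℝ 2 a Λ)
    {x y : Fin P → ℝ} {d : ℝ} {γ : ℝ → (Fin P → ℝ)} (hγ : IsShortestCurve a Λ x y d γ)
    {s : ℝ} (hs : s ∈ Set.Ioo 0 d) (v : Fin P → ℝ) :
    inner ℝ (deriv (deriv fun r => a (γ r)) s) (fderiv ℝ a (γ s) v) = 0 := by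
  refine le_antisymm (hγ.inner_acceleration_nonpos hΛ ha hs v) ?_
  -- Reversing the direction of the variation gives the other inequality.
  have := hγ.inner_acceleration_nonpos hΛ ha hs (-v)
  rw [map_neg, inner_neg_right] at this
  linarith

/-! ### Shortest curves as geodesics, and their curvature -/

theorem IsShortestCurve.isGeodesicOn (hΛ : IsOpen Λ) (ha : ContDiffOn ℝ 2 a Λ)
    (hG : ∀ x ∈ Λ, (metric a x).PosDef)
    {x y : Fin P → ℝ} {d : ℝ} {γ : ℝ → (Fin P → ℝ)} (hγ : IsShortestCurve a Λ x y d γ) :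
    IsGeodesicOn a Λ γ (Set.Ioo 0 d) where
  mem s hs := hγ.mem s (Set.Ioo_subset_Icc_self hs)
  contDiffOn := hγ.contDiffOn.mono Set.Ioo_subset_Icc_self
  equation s hs k := by
    have hm := hγ.mem s (Set.Ioo_subset_Icc_self hs)
    have had := ha.contDiffAt (hΛ.mem_nhds hm)
    refine geodesic_equation_of_normal had (hG _ hm) _ _ (fun w => ?_) k
    rw [← deriv_deriv_comp_curve had (hγ.contDiffOn.contDiffAt (Icc_mem_nhds hs.1 hs.2))]
    exact hγ.inner_acceleration_eq_zero hΛ ha hs w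

theorem IsGeodesicOn.comp_const_add {γ : ℝ → (Fin P → ℝ)} {I J : Set ℝ}
    (hγ : IsGeodesicOn a Λ γ I) (s : ℝ) (hJ : ∀ r ∈ J, s + r ∈ I) :
    IsGeodesicOn a Λ (fun r => γ (s + r)) J where
  mem r hr := hγ.mem _ (hJ r hr)
  contDiffOn := hγ.contDiffOn.comp (by fun_prop) hJ
  equation r hr k := by
    have h : deriv (fun r => γ (s + r)) = fun r => deriv γ (s + r) :=
      funext (deriv_comp_const_add γ s)
    rw [h, deriv_comp_const_add]
    exact hγ.equation _ (hJ r hr) k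

/-- The curvature of the image of a shortest curve is at most the maximal curvature. -/
theorem IsShortestCurve.norm_acceleration_le (hΛ : IsOpen Λ) (ha : ContDiffOn ℝ 2 a Λ)
    (hG : ∀ x ∈ Λ, (metric a x).PosDef) (hK : maxCurvature a Λ ≠ ⊤)
    {x y : Fin P → ℝ} {d : ℝ} {γ : ℝ → (Fin P → ℝ)} (hγ : IsShortestCurve a Λ x y d γ)
    {s : ℝ} (hs : s ∈ Set.Ioo 0 d) :
    ‖deriv (deriv fun r => a (γ r)) s‖ ≤ (maxCurvature a Λ).toReal := by
  obtain ⟨ε, hε, hball⟩ := Metric.isOpen_iff.1 isOpen_Ioo s hs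
  -- The curvature is defined by geodesics at time `0`, so time is shifted by `s`.
  have hgeo := (hγ.isGeodesicOn hΛ ha hG).comp_const_add s (J := Set.Ioo (-ε) ε) fun r hr =>
    hball (by simpa [Real.dist_eq, abs_lt] using hr)
  have h1 : ‖deriv (deriv fun r => a (γ (s + r))) 0‖ₑ ≤ maxCurvature a Λ := by
    refine le_trans ?_ (le_iSup₂ (f := fun x (_ : x ∈ Λ) => principalCurvature a Λ x) (γ s)
      (hγ.mem s (Set.Ioo_subset_Icc_self hs)))
    refine le_trans ?_ (le_iSup₂ (deriv γ s) (hγ.unit_speed s hs))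
    refine le_trans ?_ (le_iSup₂ (fun r => γ (s + r)) ⟨ε, hε, hgeo⟩)
    refine le_trans ?_ (le_iSup₂ (by simp) (by rw [deriv_comp_const_add, add_zero]))
    exact le_rfl
  have h2 : deriv (fun r => a (γ (s + r))) = fun r => deriv (fun r => a (γ r)) (s + r) :=
    funext (deriv_comp_const_add (fun r => a (γ r)) s)
  rw [h2, deriv_comp_const_add, add_zero] at h1
  rw [← toReal_enorm]
  exact ENNReal.toReal_mono hK h1

/-! ### Quadratic lower bound for the score near a maximizer -/

/-- Split off the components along `c`: `u = f c + w` and `c'' = -c + b` with `b ⊥ c`, hence `‖b‖² ≤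
K² - 1`. Then `⟨c, u⟩⟨c'', u⟩ = -f² + f⟨b, w⟩`, and the factorization `K² - 1 = (K - 1)(K + 1)`
gives the weights for the arithmetic-geometric mean inequality that yield the multiple `(1 + K)/2`
of `f² + ‖w‖²`. -/
theorem neg_le_inner_mul_inner {c c'' u : H} {K : ℝ} (hc : ‖c‖ = 1) (hcc : inner ℝ c c'' = (-1 : ℝ))
    (hK : ‖c''‖ ≤ K) : -((1 + K) / 2 * ‖u‖ ^ 2) ≤ inner ℝ c u * inner ℝ c'' u := by
  have hK1 : 1 ≤ K := by
    have h := (abs_le.1 (abs_real_inner_le_norm c c'')).1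
    rw [hcc, hc] at h
    linarith
  obtain ⟨f, hf⟩ : ∃ f, f = inner ℝ c u := ⟨_, rfl⟩
  obtain ⟨w, hw⟩ : ∃ w, w = u - f • c := ⟨_, rfl⟩
  obtain ⟨b, hb⟩ : ∃ b, b = c'' + c := ⟨_, rfl⟩
  have hcself : inner ℝ c c = (1 : ℝ) := by rw [real_inner_self_eq_norm_sq, hc]; norm_num
  have hwn : ‖w‖ ^ 2 = ‖u‖ ^ 2 - f ^ 2 := by
    rw [hw, norm_sub_sq_real, real_inner_smul_right, norm_smul, hc, real_inner_comm, ← hf, mul_one,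
      Real.norm_eq_abs, sq_abs]
    ring
  have hbn : ‖b‖ ^ 2 ≤ K ^ 2 - 1 := by
    rw [hb, norm_add_sq_real, real_inner_comm, hcc, hc]
    nlinarith [norm_nonneg c'']
  have hbw : inner ℝ c'' u = inner ℝ b w - f := by
    rw [hw, hb, inner_sub_right, inner_add_left, inner_add_left, real_inner_smul_right,
      real_inner_smul_right, hcself, real_inner_comm c c'', hcc, ← hf]
    ring
  have hle : (f * inner ℝ b w) ^ 2 ≤ f ^ 2 * ((K ^ 2 - 1) * ‖w‖ ^ 2) := by
    rw [mul_pow]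
    refine mul_le_mul_of_nonneg_left ?_ (sq_nonneg f)
    calc (inner ℝ b w) ^ 2 ≤ (‖b‖ * ‖w‖) ^ 2 :=
          sq_le_sq' (abs_le.1 (abs_real_inner_le_norm b w)).1 (real_inner_le_norm b w)
      _ = ‖b‖ ^ 2 * ‖w‖ ^ 2 := by ring
      _ ≤ _ := mul_le_mul_of_nonneg_right hbn (sq_nonneg _)
  have habs := abs_le_of_sq_le_sq (a := f * inner ℝ b w)
    (b := ((K - 1) * f ^ 2 + (K + 1) * ‖w‖ ^ 2) / 2)
    (by nlinarith [sq_nonneg ((K - 1) * f ^ 2 - (K + 1) * ‖w‖ ^ 2)])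
    (by have := sub_nonneg.2 hK1; positivity)
  rw [← hf, hbw]
  nlinarith [(abs_le.1 habs).1]

theorem score_le_norm_sq {u : H} {x : Fin P → ℝ} (hx : ‖a x‖ = 1) : score a u x ≤ ‖u‖ ^ 2 := by
  have h := abs_real_inner_le_norm (a x) u
  rw [hx, one_mul] at h
  rw [score, ← sq_abs]
  exact pow_le_pow_left₀ (abs_nonneg _) h 2

/-- Along a shortest curve starting at a maximizer, the score decreases at most quadratically. -/
theorem IsShortestCurve.score_sub_le (hΛ : IsOpen Λ) (ha : ContDiffOn ℝ 2 a Λ)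
    (hunit : ∀ x ∈ Λ, ‖a x‖ = 1) {K : ℝ} {u : H} {x y : Fin P → ℝ} (hx : x ∈ Λ)
    (hmax : ∀ z ∈ Λ, score a u z ≤ score a u x) {d : ℝ} {γ : ℝ → (Fin P → ℝ)}
    (hγ : IsShortestCurve a Λ x y d γ)
    (hK : ∀ s ∈ Set.Ioo 0 d, ‖deriv (deriv fun r => a (γ r)) s‖ ≤ K) :
    score a u x - (1 + K) / 2 * d ^ 2 * ‖u‖ ^ 2 ≤ score a u y := by
  rcases hγ.nonneg.eq_or_lt with rfl | hd
  · rw [← hγ.source, hγ.target]; simp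
  have haΛ : ∀ z ∈ Λ, ContDiffAt ℝ 2 a z := fun z hz => ha.contDiffAt (hΛ.mem_nhds hz)
  set c : ℝ → H := fun r => a (γ r) with hc
  have hcs : ∀ s ∈ Set.Ioo 0 d, ContDiffAt ℝ 2 c s := fun s hs =>
    (haΛ _ (hγ.mem s (Set.Ioo_subset_Icc_self hs))).comp s
      (hγ.contDiffOn.contDiffAt (Icc_mem_nhds hs.1 hs.2))
  have hc1 : ∀ s ∈ Set.Ioo 0 d, HasDerivAt c (deriv c s) s := fun s hs =>
    ((hcs s hs).differentiableAt (by norm_num)).hasDerivAt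
  have hc2 : ∀ s ∈ Set.Ioo 0 d, HasDerivAt (deriv c) (deriv (deriv c) s) s := fun s hs =>
    ((contDiffAt_deriv (hcs s hs)).differentiableAt (by norm_num)).hasDerivAt
  have hcn : ∀ s ∈ Set.Ioo 0 d, ‖c s‖ = 1 := fun s hs =>
    hunit _ (hγ.mem s (Set.Ioo_subset_Icc_self hs))
  have hcn' : ∀ s ∈ Set.Ioo 0 d, ‖deriv c s‖ = 1 := fun s hs => by
    rw [(hasDerivAt_comp_curve (haΛ _ (hγ.mem s (Set.Ioo_subset_Icc_self hs)))
      ((hγ.contDiffOn.contDiffAt (Icc_mem_nhds hs.1 hs.2)).differentiableAt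
        (by norm_num)).hasDerivAt).deriv, ← tangentNorm_eq_norm_fderiv]
    exact hγ.unit_speed s hs
  have hcc' : ∀ s ∈ Set.Ioo 0 d, inner ℝ (c s) (deriv c s) = (0 : ℝ) := by
    intro s hs
    have h1 := (hc1 s hs).inner ℝ (hc1 s hs)
    have h2 : (fun t => inner ℝ (c t) (c t)) =ᶠ[nhds s] fun _ => (1 : ℝ) := by
      filter_upwards [isOpen_Ioo.mem_nhds hs] with t ht
      rw [real_inner_self_eq_norm_sq, hcn t ht]; norm_num
    have h3 := h1.unique ((hasDerivAt_const s (1 : ℝ)).congr_of_eventuallyEq h2)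
    rw [real_inner_comm (c s) (deriv c s)] at h3
    linarith
  have hcc'' : ∀ s ∈ Set.Ioo 0 d, inner ℝ (c s) (deriv (deriv c) s) = (-1 : ℝ) := by
    intro s hs
    have h1 := (hc1 s hs).inner ℝ (hc2 s hs)
    have h2 : (fun t => inner ℝ (c t) (deriv c t)) =ᶠ[nhds s] fun _ => (0 : ℝ) := by
      filter_upwards [isOpen_Ioo.mem_nhds hs] with t ht using hcc' t ht
    have h3 := h1.unique ((hasDerivAt_const s (0 : ℝ)).congr_of_eventuallyEq h2)
    rw [real_inner_self_eq_norm_sq, hcn' s hs] at h3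
    linarith
  obtain ⟨B, hB⟩ : ∃ B, B = (1 + K) / 2 * ‖u‖ ^ 2 := ⟨_, rfl⟩
  have hinner : ∀ {e : ℝ → H} {e' : H} {s : ℝ}, HasDerivAt e e' s →
      HasDerivAt (fun t => inner ℝ (e t) u) (inner ℝ e' u) s := fun {e e' s} he => by
    simpa using he.inner ℝ (hasDerivAt_const s u)
  -- Adding `B s²` compensates the most negative possible second derivative of the score; a convex
  -- function with zero slope at its left end is smallest there.
  have hconv : ConvexOn ℝ (Set.Icc 0 d) fun s => score a u (γ s) + B * s ^ 2 := by
    refine convexOn_of_hasDerivWithinAt2_nonneg (convex_Icc 0 d)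
      (f' := fun s => 2 * (inner ℝ (c s) u * inner ℝ (deriv c s) u) + B * (2 * s))
      (f'' := fun s => 2 * (inner ℝ (deriv c s) u * inner ℝ (deriv c s) u +
        inner ℝ (c s) u * inner ℝ (deriv (deriv c) s) u) + B * 2) ?_ ?_ ?_ ?_
    · have h1 : ContinuousOn c (Set.Icc 0 d) :=
        ha.continuousOn.comp hγ.contDiffOn.continuousOn hγ.mem
      exact ((h1.inner continuousOn_const).pow 2).add (by fun_prop)
    all_goals
      intro s hs
      rw [interior_Icc] at hs
    · have h1 := ((hinner (hc1 s hs)).pow 2).add (((hasDerivAt_id s).pow 2).const_mul B)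
      exact (h1.congr_deriv (by norm_num [mul_assoc])).hasDerivWithinAt
    · have h1 := (((hinner (hc1 s hs)).mul (hinner (hc2 s hs))).const_mul 2).add
        (((hasDerivAt_id s).const_mul 2).const_mul B)
      exact (h1.congr_deriv (by rw [mul_one])).hasDerivWithinAt
    · have h1 := neg_le_inner_mul_inner (u := u) (hcn s hs) (hcc'' s hs) (hK s hs)
      rw [← hB] at h1
      nlinarith [mul_self_nonneg (inner ℝ (deriv c s) u)]
  have hder : HasDerivWithinAt (fun s => score a u (γ s) + B * s ^ 2) 0 (Set.Icc 0 d) 0 := by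
    have h1 : DifferentiableAt ℝ (score a u) x :=
      (((haΛ x hx).differentiableAt (by norm_num)).inner ℝ (differentiableAt_const u)).pow 2
    have h2 : fderiv ℝ (score a u) x = 0 := IsLocalMax.fderiv_eq_zero <|
      Filter.eventually_of_mem (hΛ.mem_nhds hx) hmax
    have h3 := (hγ.contDiffOn.differentiableOn (by norm_num) 0
      (Set.left_mem_Icc.2 hd.le)).hasDerivWithinAt
    have h4 := h1.hasFDerivAt
    rw [h2, ← hγ.source] at h4
    have h5 := (h4.comp_hasDerivWithinAt 0 h3).add
      ((((hasDerivAt_id (0 : ℝ)).pow 2).const_mul B).hasDerivWithinAt (s := Set.Icc 0 d))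
    exact h5.congr_deriv (by norm_num)
  have hslope := hconv.le_slope_of_hasDerivWithinAt (Set.left_mem_Icc.2 hd.le)
    (Set.right_mem_Icc.2 hd.le) hd hder
  rw [slope_def_field, hγ.source, hγ.target, sub_zero, le_div_iff₀ hd, hB] at hslope
  linarith

/-- A bound for the scores of optimized seeds is, up to the density defect, a bound for the
maximal score. -/
theorem score_sub_le_of_densityRadius {K : ℝ} (hK : 0 ≤ K) {Λd : Set (Fin P → ℝ)}
    (hfin : densityRadius a Λ Λd ≠ ⊤) {u : H} {x : Fin P → ℝ} (hx : x ∈ Λ)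
    (hsub : Λd ⊆ Λ) (hshort : ∀ y ∈ Λ, ∃ d γ, IsShortestCurve a Λ x y d γ)
    (hscore : ∀ y ∈ Λ, ∀ d γ, IsShortestCurve a Λ x y d γ →
      score a u x - (1 + K) / 2 * d ^ 2 * ‖u‖ ^ 2 ≤ score a u y)
    {T : ℝ} (hT : ∀ k ∈ Λd, score a u k ≤ T) :
    score a u x - (1 + K) / 2 * (densityRadius a Λ Λd).toReal ^ 2 * ‖u‖ ^ 2 ≤ T := by
  have hinf : ⨅ k ∈ Λd, geodesicDist a Λ x k ≤ densityRadius a Λ Λd :=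
    le_iSup₂ (f := fun x (_ : x ∈ Λ) => ⨅ k ∈ Λd, geodesicDist a Λ x k) x hx
  obtain ⟨ρ, hρ⟩ : ∃ ρ, ρ = (densityRadius a Λ Λd).toReal := ⟨_, rfl⟩
  have hρ0 : 0 ≤ ρ := hρ ▸ ENNReal.toReal_nonneg
  rw [← hρ]
  -- The infimum over the seeds need not be attained, so the estimate is proved for every `ρ' > ρ`
  -- and passed to the limit.
  have key : ∀ ρ' ∈ Set.Ioi ρ, score a u x - (1 + K) / 2 * ρ' ^ 2 * ‖u‖ ^ 2 ≤ T := by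
    intro ρ' hρ'
    have h1 : ⨅ k ∈ Λd, geodesicDist a Λ x k < ENNReal.ofReal ρ' :=
      hinf.trans_lt ((ENNReal.lt_ofReal_iff_toReal_lt hfin).2 (hρ ▸ hρ'))
    simp only [iInf_lt_iff] at h1
    obtain ⟨k, hk, hlt⟩ := h1
    obtain ⟨d, γ, hγ⟩ := hshort k (hsub hk)
    rw [hγ.dist_eq, ENNReal.ofReal_lt_ofReal_iff (hρ0.trans_lt hρ')] at hlt
    have h2 : d ^ 2 ≤ ρ' ^ 2 := pow_le_pow_left₀ hγ.nonneg hlt.le 2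
    have h3 : (1 + K) / 2 * d ^ 2 * ‖u‖ ^ 2 ≤ (1 + K) / 2 * ρ' ^ 2 * ‖u‖ ^ 2 := by gcongr
    linarith [hscore k (hsub hk) d γ hγ, hT k hk]
  have hcont : Continuous fun r : ℝ => score a u x - (1 + K) / 2 * r ^ 2 * ‖u‖ ^ 2 := by fun_prop
  exact le_of_tendsto ((hcont.tendsto ρ).mono_left nhdsWithin_le_nhds)
    (Filter.eventually_of_mem self_mem_nhdsWithin key)

/-! ### Greedy factor and decay of the residuals -/

theorem bddAbove_range_score {ι : Type*} (u : H) (φ : ι → (Fin P → ℝ))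
    (hφ : ∀ i, ‖a (φ i)‖ = 1) : BddAbove (Set.range fun i => score a u (φ i)) := by
  refine ⟨‖u‖ ^ 2, ?_⟩
  rintro _ ⟨i, rfl⟩
  exact score_le_norm_sq (hφ i)

theorem greedyFactor_sq (a : (Fin P → ℝ) → H) (Λ : Set (Fin P → ℝ)) (S : Submodule ℝ H) :
    greedyFactor a Λ S ^ 2 = ⨅ u : {u : H // u ∈ S ∧ ‖u‖ = 1}, ⨆ x : Λ, score a u x :=
  Real.sq_sqrt (Real.iInf_nonneg fun _ => Real.iSup_nonneg fun _ => sq_nonneg _)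

theorem greedyFactor_sq_le_iSup {S : Submodule ℝ H} {u : H} (hu : u ∈ S) (hu1 : ‖u‖ = 1) :
    greedyFactor a Λ S ^ 2 ≤ ⨆ x : Λ, score a u x := by
  rw [greedyFactor_sq]
  refine ciInf_le (f := fun u : {u : H // u ∈ S ∧ ‖u‖ = 1} => ⨆ x : Λ, score a u x)
    ⟨0, ?_⟩ ⟨u, hu, hu1⟩
  rintro _ ⟨w, rfl⟩
  exact Real.iSup_nonneg fun _ => sq_nonneg _

theorem greedyFactor_sq_mul_norm_sq_le {S : Submodule ℝ H} {u : H} (hu : u ∈ S)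
    {x : Fin P → ℝ} (hx : x ∈ Λ) (hmax : ∀ y ∈ Λ, score a u y ≤ score a u x) :
    greedyFactor a Λ S ^ 2 * ‖u‖ ^ 2 ≤ score a u x := by
  rcases eq_or_ne u 0 with rfl | hu0
  · simp [score]
  have hn : 0 < ‖u‖ := norm_pos_iff.2 hu0
  have : Nonempty Λ := ⟨⟨x, hx⟩⟩
  have h1 : greedyFactor a Λ S ^ 2 ≤ (‖u‖⁻¹) ^ 2 * score a u x := by
    refine (greedyFactor_sq_le_iSup (S.smul_mem ‖u‖⁻¹ hu) ?_).trans (ciSup_le fun y => ?_)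
    · rw [norm_smul, norm_inv, norm_norm, inv_mul_cancel₀ hn.ne']
    · rw [score, real_inner_smul_right, mul_pow]
      exact mul_le_mul_of_nonneg_left (hmax y y.2) (sq_nonneg _)
  rwa [inv_pow, ← div_eq_inv_mul, le_div_iff₀ (by positivity)] at h1

/-- An atom is itself an admissible unit vector. The bound keeps the contraction factor `1 - q`
nonnegative in the induction on the residuals. -/
theorem greedyFactor_sq_le_one {S : Submodule ℝ H} (hunit : ∀ x ∈ Λ, ‖a x‖ = 1)
    (hS : ∀ x ∈ Λ, a x ∈ S) (hne : Λ.Nonempty) : greedyFactor a Λ S ^ 2 ≤ 1 := by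
  obtain ⟨x, hx⟩ := hne
  have : Nonempty Λ := ⟨⟨x, hx⟩⟩
  refine (greedyFactor_sq_le_iSup (hS x hx) (hunit x hx)).trans (ciSup_le fun y => ?_)
  have := score_le_norm_sq (u := a x) (hunit y y.2)
  rwa [hunit x hx, one_pow] at this

/-- Exponential decay of the residuals of a pursuit whose steps capture a fixed proportion `q` of
the energy. -/
theorem norm_residual_sq_le {S : Submodule ℝ H} {q : ℝ} (hq : q ≤ 1) {f : H} (hf : f ∈ S)
    {R : ℕ → H} (h0 : R 0 = f) {x : ℕ → (Fin P → ℝ)}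
    (hx : ∀ m, R m ∈ S → ‖a (x (m + 1))‖ = 1 ∧ a (x (m + 1)) ∈ S ∧
      q * ‖R m‖ ^ 2 ≤ score a (R m) (x (m + 1)))
    (hR : ∀ m, R (m + 1) = R m - (inner ℝ (a (x (m + 1))) (R m)) • a (x (m + 1))) (m : ℕ) :
    ‖R m‖ ^ 2 ≤ (1 - q) ^ m * ‖f‖ ^ 2 := by
  have hmem : ∀ m, R m ∈ S := by
    intro m
    induction m with
    | zero => rwa [h0]
    | succ m ih => rw [hR]; exact S.sub_mem ih (S.smul_mem _ (hx m ih).2.1)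
  induction m with
  | zero => simp [h0]
  | succ m ih =>
    obtain ⟨hn, -, hs⟩ := hx m (hmem m)
    have h1 : ‖R (m + 1)‖ ^ 2 = ‖R m‖ ^ 2 - score a (R m) (x (m + 1)) := by
      rw [hR, norm_sub_sq_real, real_inner_smul_right, norm_smul, hn, real_inner_comm (a (x (m + 1))), mul_one,
        Real.norm_eq_abs, sq_abs, score]
      ring
    calc ‖R (m + 1)‖ ^ 2 ≤ (1 - q) * ‖R m‖ ^ 2 := by rw [h1]; linarith
      _ ≤ (1 - q) * ((1 - q) ^ m * ‖f‖ ^ 2) := mul_le_mul_of_nonneg_left ih (by linarith)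
      _ = _ := by ring

theorem score_le_score_gradAscent {u : H} {t : ℕ → ℝ} {k : Fin P → ℝ}
    (ht : IsAscentStepping a Λ u t k) (r : ℕ) :
    score a u k ≤ score a u (gradAscent a u t k r) :=
  monotone_nat_of_le_succ (f := fun r => score a u (gradAscent a u t k r)) ht.ascent r.zero_le

theorem weakness_sq {c α β ρ K : ℝ} (h : 0 ≤ 1 - c * (β ^ 2)⁻¹ * ρ ^ 2 * (1 + K)) :
    weakness c α β ρ K ^ 2 = α ^ 2 * (1 - c * (β ^ 2)⁻¹ * ρ ^ 2 * (1 + K)) := by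
  rw [weakness, mul_pow, Real.sq_sqrt h]

/-- The rate of a pursuit whose steps capture the proportion `w²` of the maximal score. -/
theorem norm_residual_sq_le_of_weak {S : Submodule ℝ H} (hunit : ∀ x ∈ Λ, ‖a x‖ = 1)
    (hS : ∀ x ∈ Λ, a x ∈ S)
    (hmax : ∀ u ∈ S, ∃ x ∈ Λ, ∀ y ∈ Λ, score a u y ≤ score a u x)
    {w : ℝ} (hw : w ^ 2 ≤ 1) {f : H} (hf : f ∈ S) {R : ℕ → H} (h0 : R 0 = f)
    {x : ℕ → (Fin P → ℝ)}
    (hx : ∀ m, R m ∈ S → x (m + 1) ∈ Λ ∧ ∀ z ∈ Λ, (∀ y ∈ Λ, score a (R m) y ≤ score a (R m) z) →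
      w ^ 2 * score a (R m) z ≤ score a (R m) (x (m + 1)))
    (hR : ∀ m, R (m + 1) = R m - (inner ℝ (a (x (m + 1))) (R m)) • a (x (m + 1))) (m : ℕ) :
    ‖R m‖ ^ 2 ≤ (1 - w ^ 2 * greedyFactor a Λ S ^ 2) ^ m * ‖f‖ ^ 2 := by
  -- Existence of a best atom for the zero vector shows that `Λ` is nonempty.
  obtain ⟨z, hz, -⟩ := hmax 0 S.zero_mem
  refine norm_residual_sq_le (mul_le_one₀ hw (sq_nonneg _)
    (greedyFactor_sq_le_one hunit hS ⟨z, hz⟩)) hf h0 (fun m hm => ?_) hR m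
  obtain ⟨hxm, hsel⟩ := hx m hm
  refine ⟨hunit _ hxm, hS _ hxm, ?_⟩
  obtain ⟨y, hy, hym⟩ := hmax _ hm
  calc w ^ 2 * greedyFactor a Λ S ^ 2 * ‖R m‖ ^ 2
      = w ^ 2 * (greedyFactor a Λ S ^ 2 * ‖R m‖ ^ 2) := by ring
    _ ≤ w ^ 2 * score a (R m) y :=
      mul_le_mul_of_nonneg_left (greedyFactor_sq_mul_norm_sq_le hm hy hym) (sq_nonneg w)
    _ ≤ _ := hsel y hy hym

theorem IsMP.norm_sq_le {S : Submodule ℝ H} (hunit : ∀ x ∈ Λ, ‖a x‖ = 1)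
    (hS : ∀ x ∈ Λ, a x ∈ S)
    (hmax : ∀ u ∈ S, ∃ x ∈ Λ, ∀ y ∈ Λ, score a u y ≤ score a u x)
    {w : ℝ} (hw : w ^ 2 ≤ 1) {f : H} (hf : f ∈ S) {R : ℕ → H} {x : ℕ → (Fin P → ℝ)}
    (h : IsMP a Λ w f R x) (m : ℕ) :
    ‖R m‖ ^ 2 ≤ (1 - w ^ 2 * greedyFactor a Λ S ^ 2) ^ m * ‖f‖ ^ 2 := by
  refine norm_residual_sq_le_of_weak hunit hS hmax hw hf h.init
    (fun m _ => ⟨h.mem m, fun z hz _ => ?_⟩) h.residual m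
  refine le_trans (mul_le_mul_of_nonneg_left ?_ (sq_nonneg w)) (h.select m)
  exact le_ciSup (f := fun y : Λ => score a (R m) y)
    (bddAbove_range_score (R m) (fun y : Λ => (y : Fin P → ℝ)) fun y => hunit y y.2) ⟨z, hz⟩

/-- The rate of the geometrically optimized matching pursuit, valid for every number of gradient
ascent steps. -/
theorem IsGMP.norm_sq_le (hΛ : IsOpen Λ) (ha : ContDiffOn ℝ 2 a Λ)
    (hG : ∀ x ∈ Λ, (metric a x).PosDef)
    (hshort : ∀ x ∈ Λ, ∀ y ∈ Λ, ∃ d γ, IsShortestCurve a Λ x y d γ)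
    {S : Submodule ℝ H} (hunit : ∀ x ∈ Λ, ‖a x‖ = 1) (hS : ∀ x ∈ Λ, a x ∈ S)
    (hmax : ∀ u ∈ S, ∃ x ∈ Λ, ∀ y ∈ Λ, score a u y ≤ score a u x)
    (hβ : greedyFactor a Λ S ≠ 0) (hK : maxCurvature a Λ ≠ ⊤)
    {Λd : Set (Fin P → ℝ)} (hsub : Λd ⊆ Λ) (hfin : densityRadius a Λ Λd ≠ ⊤)
    {t : H → (Fin P → ℝ) → ℕ → ℝ} (ht : ∀ u ∈ S, ∀ k ∈ Λd, IsAscentStepping a Λ u (t u k) k)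
    {α w : ℝ} (hw1 : w ^ 2 ≤ 1)
    (hw : w ^ 2 = α ^ 2 * (1 - 1 / 2 * (greedyFactor a Λ S ^ 2)⁻¹ *
      (densityRadius a Λ Λd).toReal ^ 2 * (1 + (maxCurvature a Λ).toReal)))
    {κ : ℕ → ℕ} {f : H} (hf : f ∈ S) {R : ℕ → H} {ν : ℕ → (Fin P → ℝ)}
    (h : IsGMP a Λd t κ α f R ν) (m : ℕ) :
    ‖R m‖ ^ 2 ≤ (1 - w ^ 2 * greedyFactor a Λ S ^ 2) ^ m * ‖f‖ ^ 2 := by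
  refine norm_residual_sq_le_of_weak hunit hS hmax hw1 hf h.init (fun m hm => ⟨?_, ?_⟩)
    h.residual m
  · obtain ⟨k, hk, hν⟩ := h.mem m
    rw [hν]
    exact (ht _ hm k hk).mem _
  · intro z hz hzm
    refine le_trans ?_ (h.select m)
    rw [hw, mul_assoc]
    refine mul_le_mul_of_nonneg_left ?_ (sq_nonneg α)
    have hT := score_sub_le_of_densityRadius (K := (maxCurvature a Λ).toReal)
      ENNReal.toReal_nonneg hfin hz hsub (hshort z hz)
      (fun y hy d γ hγ => hγ.score_sub_le hΛ ha hunit hz hzm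
        fun s hs => hγ.norm_acceleration_le hΛ ha hG hK hs)
      (T := ⨆ k : Λd, score a (R m) (gradAscent a (R m) (t (R m) k) k (κ m)))
      fun k hk => (score_le_score_gradAscent (ht _ hm k hk) (κ m)).trans
        (le_ciSup (f := fun k : Λd => score a (R m) (gradAscent a (R m) (t (R m) k) k (κ m)))
          (bddAbove_range_score (R m)
            (fun k : Λd => gradAscent a (R m) (t (R m) k) k (κ m))
            fun k => hunit _ ((ht _ hm k k.2).mem _)) ⟨k, hk⟩)
    refine le_trans ?_ hT
    have hβ2 : 0 < greedyFactor a Λ S ^ 2 := by positivity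
    -- The greedy factor turns the additive loss, a multiple of `‖R m‖²`, into a proportion of the
    -- best score.
    have h1 : ‖R m‖ ^ 2 ≤ (greedyFactor a Λ S ^ 2)⁻¹ * score a (R m) z := by
      rw [inv_mul_eq_div, le_div_iff₀ hβ2, mul_comm]
      exact greedyFactor_sq_mul_norm_sq_le hm hz hzm
    have h2 := mul_le_mul_of_nonneg_left h1 (show 0 ≤ (1 + (maxCurvature a Λ).toReal) / 2 *
      (densityRadius a Λ Λd).toReal ^ 2 by positivity)
    linarith

end GeomMP

/-! ### Assembly of the theorem -/

theorem theorem2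
    {X : Type*} [MeasurableSpace X] (μ : MeasureTheory.Measure X)
    {P : ℕ} (Λ : Set (Fin P → ℝ)) (hΛ : IsOpen Λ)
    -- the mother function and the isometric operators
    (g : MeasureTheory.Lp ℝ 2 μ) (hg : ‖g‖ = 1)
    (U : (Fin P → ℝ) → (MeasureTheory.Lp ℝ 2 μ →ₗᵢ[ℝ] MeasureTheory.Lp ℝ 2 μ))
    (a : (Fin P → ℝ) → MeasureTheory.Lp ℝ 2 μ) (ha : ∀ x, a x = U x g)
    -- standing assumptions on the dictionary
    (hsmooth : ContDiffOn ℝ 2 a Λ)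
    (hnondeg : ∀ x ∈ Λ, (GeomMP.metric a x).PosDef)
    (hshort : ∀ x ∈ Λ, ∀ y ∈ Λ, ∃ d γ, GeomMP.IsShortestCurve a Λ x y d γ)
    -- the space, its greedy factor, and the existence of best atoms
    (S : Submodule ℝ (MeasureTheory.Lp ℝ 2 μ)) (hS : ∀ x ∈ Λ, a x ∈ S)
    (hmax : ∀ u ∈ S, ∃ x ∈ Λ, ∀ y ∈ Λ, GeomMP.score a u y ≤ GeomMP.score a u x)
    (β : ℝ) (hβ : β = GeomMP.greedyFactor a Λ S) (hβ0 : β ≠ 0)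
    -- the condition number
    (hcond : GeomMP.conditionNumber a Λ ≠ 0)
    (K : ℝ) (hK : K = (GeomMP.maxCurvature a Λ).toReal)
    -- the discretization and its density
    (Λd : Set (Fin P → ℝ)) (hcount : Λd.Countable) (hsub : Λd ⊆ Λ)
    (hdense : GeomMP.densityRadius a Λ Λd < ENNReal.ofReal (β / √(1 + K)))
    (ρ : ℝ) (hρ : ρ = (GeomMP.densityRadius a Λ Λd).toReal)
    -- the weakness factor, and the step sizes of the gradient ascent
    (α : ℝ) (hα0 : 0 < α) (hα1 : α ≤ 1)
    (t : MeasureTheory.Lp ℝ 2 μ → (Fin P → ℝ) → ℕ → ℝ)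
    (ht : ∀ u ∈ S, ∀ k ∈ Λd, GeomMP.IsAscentStepping a Λ u (t u k) k)
    -- the weakness factors of dMP and of gMP
    (α' α'' : ℝ) (hα' : α' = GeomMP.weakness 1 α β ρ K)
    (hα'' : α'' = GeomMP.weakness (1 / 2) α β ρ K) :
    (0 < α'' ∧ α'' ≤ α ∧ α ^ 2 - α'' ^ 2 = (1 / 2) * (α ^ 2 - α' ^ 2)) ∧
    -- the exponential rate of the continuous matching pursuit with weakness `α''`
    (∀ f ∈ S, ∀ R x, GeomMP.IsMP a Λ α'' f R x →
      ∀ m : ℕ, ‖R m‖ ^ 2 ≤ (1 - α'' ^ 2 * β ^ 2) ^ m * ‖f‖ ^ 2) ∧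
    -- the same rate for the optimized matching pursuit with weakness `α`
    (∃ κ : ℕ → ℕ, (∀ m, 0 < κ m) ∧
      ∀ f ∈ S, ∀ R ν, GeomMP.IsGMP a Λd t κ α f R ν →
        ∀ m : ℕ, ‖R m‖ ^ 2 ≤ (1 - α'' ^ 2 * β ^ 2) ^ m * ‖f‖ ^ 2) := by
  have hunit : ∀ x ∈ Λ, ‖a x‖ = 1 := fun x _ => by rw [ha, LinearIsometry.norm_map, hg]
  have hKtop : GeomMP.maxCurvature a Λ ≠ ⊤ := ENNReal.inv_ne_zero.1 hcond
  have hfin : GeomMP.densityRadius a Λ Λd ≠ ⊤ := hdense.ne_top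
  have hβpos : 0 < β := lt_of_le_of_ne (hβ ▸ Real.sqrt_nonneg _) hβ0.symm
  have hK0 : 0 ≤ K := hK ▸ ENNReal.toReal_nonneg
  have hρ0 : 0 ≤ ρ := hρ ▸ ENNReal.toReal_nonneg
  have hρlt : ρ * √(1 + K) < β := by
    rw [hρ, ← lt_div_iff₀ (Real.sqrt_pos.2 (by linarith))]
    exact (ENNReal.lt_ofReal_iff_toReal_lt hfin).1 hdense
  -- The density hypothesis says exactly `δ < 1`; then `α'² = α²(1 - δ)` and `α''² = α²(1 - δ/2)`,
  -- so the defect is halved.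
  obtain ⟨δ, hδ⟩ : ∃ δ, δ = (β ^ 2)⁻¹ * ρ ^ 2 * (1 + K) := ⟨_, rfl⟩
  have hδ0 : 0 ≤ δ := by rw [hδ]; positivity
  have hδ1 : δ < 1 := by
    have h1 : (ρ * √(1 + K)) ^ 2 < β ^ 2 := pow_lt_pow_left₀ hρlt (by positivity) two_ne_zero
    rw [mul_pow, Real.sq_sqrt (by linarith)] at h1
    rw [hδ, mul_assoc, inv_mul_eq_div, div_lt_one (by positivity)]
    exact h1
  have hhalf : 1 - 1 / 2 * (β ^ 2)⁻¹ * ρ ^ 2 * (1 + K) = 1 - δ / 2 := by rw [hδ]; ring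
  have hone : 1 - 1 * (β ^ 2)⁻¹ * ρ ^ 2 * (1 + K) = 1 - δ := by rw [hδ]; ring
  have hw : α'' ^ 2 = α ^ 2 * (1 - 1 / 2 * (β ^ 2)⁻¹ * ρ ^ 2 * (1 + K)) := by
    rw [hα'']; exact GeomMP.weakness_sq (by rw [hhalf]; linarith)
  have hw' : α' ^ 2 = α ^ 2 * (1 - 1 * (β ^ 2)⁻¹ * ρ ^ 2 * (1 + K)) := by
    rw [hα']; exact GeomMP.weakness_sq (by rw [hone]; linarith)
  have hpos : 0 < α'' := by
    rw [hα'', GeomMP.weakness, hhalf]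
    exact mul_pos hα0 (Real.sqrt_pos.2 (by linarith))
  have hle : α'' ≤ α := by
    rw [hα'', GeomMP.weakness, hhalf]
    exact mul_le_of_le_one_right hα0.le (Real.sqrt_le_one.2 (by linarith))
  have hw1 : α'' ^ 2 ≤ 1 := pow_le_one₀ hpos.le (hle.trans hα1)
  -- The rate of the optimized pursuit holds for every number of steps, so one step per iteration
  -- suffices.
  refine ⟨⟨hpos, hle, ?_⟩, fun f hf R x h m => ?_, fun _ => 1, fun _ => one_pos,
    fun f hf R ν h m => ?_⟩
  · rw [hw, hw', hhalf, hone]; ring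
  · rw [hβ]
    exact h.norm_sq_le hunit hS hmax hw1 hf m
  · subst hβ hK hρ
    exact h.norm_sq_le hΛ hsmooth hnondeg hshort hunit hS hmax hβ0 hKtop hsub hfin ht hw1 hw hf m
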